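/- Let $K,N\ge 1$ be integers and let $u(i,j)\in\mathbb N=\{0,1,2,\dots\}$ for $i\ge 1$, $1\le j\le K$. Queues. In the saturated tandem of $K$ single-server FIFO queues, all customers $1,2,3,\dots$ are present in queue $1$ at instant $0$ and the other queues are empty; $u(i,j)$ is the service time of customer $i$ in queue $j$; and the instant of departure of a customer from queue $j$ is its instant of arrival in queue $j+1$. Let $D$ be the instant of departure of customer $N$ from queue $K$. Stores. In the saturated tandem of $K$ stores, at the end of time slot $0$ store $1$ has an infinite stock and the other stores are empty; $u(i,K+1-j)$ is the request at time slot $i\ge1$ in store $j$; the amount departing from a store at a slot is the minimum of the request and of the available amount (stock at the end of the previous slot plus supply at the current slot), unmet requests are lost and the remaining amount stays in stock; and the departure at slot $n\ge 1$ from store $j$ is the supply at slot $n+1$ of store $j+1$ (there is no supply at slot $1$). Let $R$ be the cumulative departures over the time slots $1,\dots,N$ from store $K$. Tableau. Let $w(U)=w_1w_2\cdots w_N$ be the word over $\{1,\dots,K\}$ in which $w_i$ consists of $u(i,1)$ letters $1$, followed by $u(i,2)$ letters $2$, and so on up to $u(i,K)$ letters $K$. Let $(\lambda_1,\dots,\lambda_K)$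 be the shape of the tableau obtained from the empty tableau by successive Robinson–Schensted–Knuth row insertion of the letters of $w(U)$, i.e. $\lambda_k$ is the length of the $k$-th row from the top ($0$ if there is no such row). Paths. Let $\Pi$ be the set of lattice paths from $(1,1)$ to $(N,K)$ with steps $(1,0)$ or $(0,1)$. Let $\widetilde\Pi$ be the set of (non-empty) lattice paths from one of the points $(1+i,K-i)$, $0\le i\le K-1$, to one of the points $(N-j,1+j)$, $0\le j\le N-1$, with steps of the form $(1+i,-i)$, $i\ge 0$. This set is empty exactly when $N<K$, and in that case the minimum over $\widetilde\Pi$ below is $0$ by convention. Then $$\lambda_1=\max_{\pi\in\Pi}\ \sum_{(i,j)\in\pi}u(i,j)=D,\qquad \lambda_K=\min_{\pi\in\widetilde\Pi}\ \sum_{(i,j)\in\pi}u(i,j)=R .$$ -/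

import Mathlib

/-! Throughout, a family `u(i,j)`, `i ≥ 1`, `1 ≤ j ≤ K`, is a function `u : ℕ → ℕ → ℕ` with
1-based indices; values at other indices are never used. -/

namespace Tandem

/-! ### Tandem of queues -/

/-- Departure instants from a single-server FIFO queue in which customer `n ≥ 1` arrives at
instant `A n` and has service time `s n`: the service of customer `n + 1` starts as soon as this
customer has arrived and customer `n` has left. The value at `0` is the convention `D_0 = 0`. -/
def singleQueueDeparture (A s : ℕ → ℕ) : ℕ → ℕ
  | 0 => 0
  | n + 1 => max (singleQueueDeparture A s n) (A (n + 1)) + s (n + 1)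

/-- `queueDeparture u j n` is the instant of departure of customer `n` from queue `j` in the
saturated tandem: all customers `1, 2, …` are present in queue 1 at instant `0`, the service time
of customer `i` in queue `j` is `u i j`, and the departures from queue `j` are the arrivals in
queue `j + 1`. The value at `j = 0` stands for the instants of arrival in queue 1. -/
def queueDeparture (u : ℕ → ℕ → ℕ) : ℕ → ℕ → ℕ
  | 0 => fun _ => 0
  | j + 1 => singleQueueDeparture (queueDeparture u j) (fun i => u i (j + 1))

/-! ### Tandem of stores -/

/-- Level of the stock at the end of slot `n`, for a store which is empty at the end of slot `0`,
with supply `supply n` and request `request n` at slot `n ≥ 1`; unmet demand is lost, unsold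
supply is kept. (The truncated subtraction is the positive part.) -/
def storeStock (supply request : ℕ → ℕ) : ℕ → ℕ
  | 0 => 0
  | n + 1 => storeStock supply request n + supply (n + 1) - request (n + 1)

/-- Amount departing at slot `n ≥ 1` from such a store, i.e. the demand met at slot `n`; nothing
departs at slot `0`. -/
def singleStoreDeparture (supply request : ℕ → ℕ) : ℕ → ℕ
  | 0 => 0
  | n + 1 => min (storeStock supply request n + supply (n + 1)) (request (n + 1))

/-- `storeDeparture K u j n` is the amount departing at slot `n` from store `j` in the saturated
tandem of `K` stores: the request at slot `n ≥ 1` in store `j` is `u n (K + 1 - j)`; store 1 has an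
infinite stock, so that all its requests are met; the other stores start empty; the departure
from store `j` at slot `n` is the supply of store `j + 1` at slot `n + 1`. There is no departure at
slot `0`, hence no supply at slot `1` for stores `2, …, K`. There is no store `0`. -/
def storeDeparture (K : ℕ) (u : ℕ → ℕ → ℕ) : ℕ → ℕ → ℕ
  | 0 => fun _ => 0
  | 1 => fun n => if n = 0 then 0 else u n K
  | j + 2 => singleStoreDeparture (fun n => storeDeparture K u (j + 1) (n - 1))
      (fun n => u n (K + 1 - (j + 2)))

/-- Cumulative departures over the slots `1, …, N` from store `K`. -/
def totalStoreDeparture (N K : ℕ) (u : ℕ → ℕ → ℕ) : ℕ :=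
  ∑ n ∈ Finset.Icc 1 N, storeDeparture K u K n

/-! ### Row insertion -/

/-- Insertion of the label `a` in a row: the leftmost label strictly larger than `a` is replaced
by `a` and returned (it is bumped); if there is none, `a` is added at the end of the row. -/
def rowInsert (a : ℕ) : List ℕ → List ℕ × Option ℕ
  | [] => ([a], none)
  | b :: r =>
    if a < b then (a :: r, some b)
    else (b :: (rowInsert a r).1, (rowInsert a r).2)

/-- The tableau `T ← a`; a tableau is given by the list of its rows, from top to bottom. -/
def tableauInsert : List (List ℕ) → ℕ → List (List ℕ)
  | [], a => [[a]]
  | row :: T, a =>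
    match rowInsert a row with
    | (row', none) => row' :: T
    | (row', some b) => row' :: tableauInsert T b

/-- The tableau `(⋯((∅ ← v₁) ← v₂)⋯ ← v_n)` associated with the word `v₁ ⋯ v_n`. -/
def insertionTableau (v : List ℕ) : List (List ℕ) :=
  v.foldl tableauInsert []

/-- The length of the `k`-th row (`k ≥ 1`) of the tableau, counted from the top; it is `0` if
there are fewer than `k` rows. -/
def rowLength (T : List (List ℕ)) (k : ℕ) : ℕ :=
  (T.getD (k - 1) []).length

/-- The word `w(U) = w_1 ⋯ w_N`, where `w_i` consists of `u i 1` letters `1`, followed by `u i 2`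
letters `2`, …, followed by `u i K` letters `K`. -/
def word (N K : ℕ) (u : ℕ → ℕ → ℕ) : List ℕ :=
  (List.range N).flatMap fun i =>
    (List.range K).flatMap fun j => List.replicate (u (i + 1) (j + 1)) (j + 1)

/-! ### Lattice paths -/

/-- Steps of the type `(1, 0)` or `(0, 1)`. -/
def IsUpRightStep (p q : ℕ × ℕ) : Prop :=
  q = (p.1 + 1, p.2) ∨ q = (p.1, p.2 + 1)

/-- Steps of the type `(1 + i, -i)`, `i ≥ 0`. -/
def IsDownStep (p q : ℕ × ℕ) : Prop :=
  ∃ i : ℕ, q.1 = p.1 + (1 + i) ∧ q.2 + i = p.2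

/-- The set `Π` of lattice paths from `(1, 1)` to `(N, K)` with steps `(1, 0)` or `(0, 1)`. -/
def upRightPaths (N K : ℕ) : Set (List (ℕ × ℕ)) :=
  {π | π.head? = some (1, 1) ∧ π.getLast? = some (N, K) ∧ π.IsChain IsUpRightStep}

/-- The set `Π̃` of (non-empty) lattice paths from one of the points `(1 + i, K - i)`,
`0 ≤ i ≤ K - 1`, to one of the points `(N - j, 1 + j)`, `0 ≤ j ≤ N - 1`, with steps
`(1 + i, -i)`, `i ≥ 0`. -/
def downPaths (N K : ℕ) : Set (List (ℕ × ℕ)) :=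
  {π | (∃ i < K, π.head? = some (1 + i, K - i)) ∧
    (∃ j < N, π.getLast? = some (N - j, 1 + j)) ∧ π.IsChain IsDownStep}

/-- The sum `∑_{(i,j) ∈ π} u(i,j)` over the nodes of a path. -/
def pathWeight (u : ℕ → ℕ → ℕ) (π : List (ℕ × ℕ)) : ℕ :=
  (π.map fun p => u p.1 p.2).sum

end Tandem

namespace Tandem

/-! The first row of the tableau behaves as the tandem of queues. If `queueDeparture u j n` is the
number of letters at most `j` in it after `n` blocks, inserting the next block yields the queue
recursion, which is also the recursion for maximal up-right path weights. The letters bumped by a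
block again form a weakly increasing block, so deleting the first row amounts to replacing `u` by
`bumpArray u` (`rowInsertWord_word`).

The bumped letters are the output of a store whose stock is the backlog of a queue and whose
requests are the increments of its arrivals (`partialSum_queueBump`). By the exchange identity
`storeCum_storeCum_queue`, a queue can be pushed through a chain of stores, so the chain for
`bumpArray u` is the chain for `u` with one extra store, whose requests are increments of a queue
departure process (`storeChain_bumpArray`). Each bumping removes the smallest remaining letter, so
in the end that process is the partial sum of a single column and the extra store is the next store
of the original tandem (`rowLength_word_eq_storeChain`). Unfolding the minimum in the store
recursion gives the paths in `downPaths`. -/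

/-! ### Cumulative form of a store -/

/-- The increments of a sequence. -/
def increment (A : ℕ → ℕ) (n : ℕ) : ℕ := A n - A (n - 1)

/-- The partial sums of a sequence indexed from `1`. -/
def partialSum (f : ℕ → ℕ) (n : ℕ) : ℕ := ∑ i ∈ Finset.range n, f (i + 1)

lemma partialSum_zero (f : ℕ → ℕ) : partialSum f 0 = 0 := by simp [partialSum]

lemma partialSum_succ (f : ℕ → ℕ) (n : ℕ) :
    partialSum f (n + 1) = partialSum f n + f (n + 1) := by
  simp [partialSum, Finset.sum_range_succ]

/-- Cumulative departures from a store with cumulative supply `X`, delayed by one slot, and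
requests `y`. -/
def storeCum (X y : ℕ → ℕ) : ℕ → ℕ
  | 0 => 0
  | n + 1 => min (storeCum X y n + y (n + 1)) (X n)

lemma storeCum_congr {X y z : ℕ → ℕ} (h : ∀ n, y (n + 1) = z (n + 1)) (n : ℕ) :
    storeCum X y n = storeCum X z n := by
  induction n with
  | zero => rfl
  | succ n ih => rw [storeCum, storeCum, ih, h]

/-- Decrease of the backlog of a queue, seen as the departures from a store. -/
def queueBump (A b : ℕ → ℕ) (n : ℕ) : ℕ :=
  (singleQueueDeparture A b (n - 1) - A (n - 1)) + b n - (singleQueueDeparture A b n - A n)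

lemma le_singleQueueDeparture {A b : ℕ → ℕ} (hA0 : A 0 = 0) (n : ℕ) :
    A n ≤ singleQueueDeparture A b n := by
  cases n with
  | zero => simp [hA0]
  | succ n => simp only [singleQueueDeparture]; omega

lemma singleQueueDeparture_mono (A b : ℕ → ℕ) : Monotone (singleQueueDeparture A b) :=
  monotone_nat_of_le_succ fun n => by simp only [singleQueueDeparture]; omega

lemma partialSum_queueBump {A b : ℕ → ℕ} (hA : Monotone A) (hA0 : A 0 = 0) (n : ℕ) :
    partialSum (queueBump A b) n = storeCum (partialSum b) (increment A) n := by
  -- The second conjunct is conservation: cumulative input is cumulative output plus backlog.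
  suffices h : partialSum (queueBump A b) n = storeCum (partialSum b) (increment A) n ∧
      partialSum b n =
        partialSum (queueBump A b) n + (singleQueueDeparture A b n - A n) from h.1
  induction n with
  | zero => simp [partialSum_zero, storeCum, singleQueueDeparture]
  | succ n ih =>
    obtain ⟨h1, h2⟩ := ih
    have hle := le_singleQueueDeparture (b := b) hA0 n
    have hm : A n ≤ A (n + 1) := hA n.le_succ
    simp only [partialSum_succ, storeCum, increment, queueBump, singleQueueDeparture,
      Nat.add_sub_cancel] at *
    omega

/-- A queue followed by its complementary store can be exchanged with the two original stores. -/
lemma storeCum_storeCum_queue {A : ℕ → ℕ} (Z b : ℕ → ℕ) (hA : Monotone A) (hA0 : A 0 = 0)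
    (n : ℕ) :
    storeCum (storeCum Z (increment (singleQueueDeparture A b))) (queueBump A b) n =
      storeCum (storeCum Z b) (increment A) n := by
  -- The equality alone is not inductive. The second conjunct expresses the intermediate flow on the
  -- right through the common output, the backlog of the queue and the intermediate flow on the
  -- left.
  suffices h : storeCum (storeCum Z (increment (singleQueueDeparture A b))) (queueBump A b) n =
      storeCum (storeCum Z b) (increment A) n ∧
      storeCum Z b n = min (storeCum (storeCum Z b) (increment A) n +
        (singleQueueDeparture A b n - A n))
        (storeCum Z (increment (singleQueueDeparture A b)) n) from h.1
  induction n with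
  | zero => simp [storeCum]
  | succ n ih =>
    obtain ⟨h1, h2⟩ := ih
    have hle := le_singleQueueDeparture (b := b) hA0 n
    have hm : A n ≤ A (n + 1) := hA n.le_succ
    simp only [storeCum, increment, queueBump, singleQueueDeparture, Nat.add_sub_cancel] at *
    omega

/-- Cumulative departures from store `m + 1` of the saturated tandem of stores. -/
def storeChain (K : ℕ) (u : ℕ → ℕ → ℕ) : ℕ → ℕ → ℕ
  | 0 => partialSum fun n => u n K
  | m + 1 => storeCum (storeChain K u m) fun n => u n (K - (m + 1))

lemma storeChain_zero_right (K : ℕ) (u : ℕ → ℕ → ℕ) (m : ℕ) : storeChain K u m 0 = 0 := by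
  cases m <;> simp [storeChain, partialSum, storeCum]

/-- Each passage to the next store costs one slot. This settles the case `N < K` and gives the
starting value of the minimal paths. -/
lemma storeChain_eq_zero (K : ℕ) (u : ℕ → ℕ → ℕ) (m n : ℕ) (h : n ≤ m) :
    storeChain K u m n = 0 := by
  induction m generalizing n with
  | zero => obtain rfl : n = 0 := by omega
            exact storeChain_zero_right ..
  | succ m ih =>
    cases n with
    | zero => exact storeChain_zero_right ..
    | succ n => simp only [storeChain, storeCum, ih n (by omega), Nat.min_zero]

lemma partialSum_singleStoreDeparture (X supply request : ℕ → ℕ)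
    (hX : ∀ n, partialSum supply (n + 1) = X n) (n : ℕ) :
    partialSum (singleStoreDeparture supply request) n = storeCum X request n := by
  suffices h : partialSum (singleStoreDeparture supply request) n = storeCum X request n ∧
      storeStock supply request n + partialSum (singleStoreDeparture supply request) n =
        partialSum supply n from h.1
  induction n with
  | zero => simp [partialSum_zero, storeCum, storeStock]
  | succ n ih =>
    have := hX n
    simp only [partialSum_succ, storeCum, storeStock, singleStoreDeparture] at *
    omega

lemma storeDeparture_zero_right (K : ℕ) (u : ℕ → ℕ → ℕ) (j : ℕ) : storeDeparture K u j 0 = 0 := by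
  match j with
  | 0 => rfl
  | 1 => rfl
  | j + 2 => rfl

lemma partialSum_storeDeparture (K : ℕ) (u : ℕ → ℕ → ℕ) (m n : ℕ) :
    partialSum (storeDeparture K u (m + 1)) n = storeChain K u m n := by
  induction m generalizing n with
  | zero => simp [partialSum, storeDeparture, storeChain]
  | succ m ih =>
    have hreq : (fun n => u n (K + 1 - (m + 2))) = fun n => u n (K - (m + 1)) := by
      funext n; congr 1; omega
    rw [show m + 1 + 1 = m + 2 from rfl, storeDeparture, storeChain, hreq]
    refine partialSum_singleStoreDeparture _ _ _ (fun n => ?_) n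
    rw [← ih n]
    simp [partialSum, Finset.sum_range_succ', storeDeparture_zero_right]

lemma totalStoreDeparture_eq_storeChain (N K : ℕ) (u : ℕ → ℕ → ℕ) :
    totalStoreDeparture N (K + 1) u = storeChain (K + 1) u K N := by
  rw [← partialSum_storeDeparture, totalStoreDeparture, partialSum, Finset.range_eq_Ico,
    Finset.sum_Ico_add' (fun i => storeDeparture (K + 1) u (K + 1) i) 0 N 1]
  rfl

/-! ### Queues -/

lemma queueDeparture_zero_right (u : ℕ → ℕ → ℕ) (j : ℕ) : queueDeparture u j 0 = 0 := by
  cases j <;> rfl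

lemma queueDeparture_mono (u : ℕ → ℕ → ℕ) (j : ℕ) : Monotone (queueDeparture u j) := by
  cases j with
  | zero => exact fun _ _ _ => le_rfl
  | succ j => exact singleQueueDeparture_mono _ _

lemma queueDeparture_le_succ (u : ℕ → ℕ → ℕ) (j n : ℕ) :
    queueDeparture u j n ≤ queueDeparture u (j + 1) n :=
  le_singleQueueDeparture (queueDeparture_zero_right u j) n

/-- The numbers `u' n j` of letters `j` which are bumped from the first row at time `n`. -/
def bumpArray (u : ℕ → ℕ → ℕ) (n j : ℕ) : ℕ :=
  queueBump (queueDeparture u (j - 1)) (fun i => u i j) n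

lemma queueDeparture_eq_zero {u : ℕ → ℕ → ℕ} {s : ℕ} (hu : ∀ n, ∀ j < s, u (n + 1) (j + 1) = 0) (n : ℕ) :
    queueDeparture u s n = 0 := by
  induction s generalizing n with
  | zero => rfl
  | succ s ih =>
    have ih := ih fun n j hj => hu n j (by omega)
    induction n with
    | zero => rfl
    | succ n ihn =>
      rw [queueDeparture] at ihn ⊢
      simp [singleQueueDeparture, ihn, ih, hu]

lemma queueDeparture_succ_of_eq_zero {u : ℕ → ℕ → ℕ} {s : ℕ} (hu : ∀ n, ∀ j < s, u (n + 1) (j + 1) = 0)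
    (n : ℕ) : queueDeparture u (s + 1) n = partialSum (fun n => u n (s + 1)) n := by
  induction n with
  | zero => rfl
  | succ n ih =>
    rw [partialSum_succ, ← ih]
    simp [queueDeparture, singleQueueDeparture, queueDeparture_eq_zero hu]

/-- A bumped letter is strictly larger than the letter that bumps it, so the least possible letter
rises by one. In queue terms, a queue whose arrivals are all at instant `0` has a backlog that never
decreases. -/
lemma bumpArray_eq_zero {u : ℕ → ℕ → ℕ} {s : ℕ} (hu : ∀ n, ∀ j < s, u (n + 1) (j + 1) = 0) 
    (n j : ℕ) (hj : j < s + 1) : bumpArray u (n + 1) (j + 1) = 0 := by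
  have h0 : ∀ i, queueDeparture u j i = 0 :=
    queueDeparture_eq_zero fun n i hi => hu n i (by omega)
  simp [bumpArray, queueBump, singleQueueDeparture, h0]

/-- The queue with index `K - (m + 1)` is pushed one store further at each induction step by the
exchange identity. -/
lemma storeChain_bumpArray (K : ℕ) (u : ℕ → ℕ → ℕ) (m : ℕ) (hm : m < K) :
    storeChain K (bumpArray u) m =
      storeCum (storeChain K u m) (increment (queueDeparture u (K - (m + 1)))) := by
  induction m with
  | zero =>
    funext n
    exact partialSum_queueBump (queueDeparture_mono u _) (queueDeparture_zero_right u _) n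
  | succ m ih =>
    funext n
    have e : K - (m + 1) = K - (m + 1 + 1) + 1 := by omega
    rw [storeChain, ih (by omega), storeChain]
    have := storeCum_storeCum_queue (storeChain K u m) (fun n => u n (K - (m + 1)))
      (queueDeparture_mono u (K - (m + 1 + 1))) (queueDeparture_zero_right u _) n
    rw [← this]
    congr 2
    · congr 1
      conv_lhs => rw [e]
      rw [queueDeparture, ← e]

/-! ### Row insertion of a word -/

/-- Insertion of the letters of a word in a row; the second component is the word of the bumped
letters. -/
def rowInsertWord : List ℕ → List ℕ → List ℕ × List ℕ
  | [], row => (row, [])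
  | a :: w, row =>
    ((rowInsertWord w (rowInsert a row).1).1,
      (rowInsert a row).2.toList ++ (rowInsertWord w (rowInsert a row).1).2)

lemma rowInsertWord_append (v w row : List ℕ) :
    rowInsertWord (v ++ w) row = ((rowInsertWord w (rowInsertWord v row).1).1,
      (rowInsertWord v row).2 ++ (rowInsertWord w (rowInsertWord v row).1).2) := by
  induction v generalizing row with
  | nil => simp [rowInsertWord]
  | cons a v ih => simp [rowInsertWord, ih]

lemma foldl_tableauInsert_cons (w row : List ℕ) (T : List (List ℕ)) :
    w.foldl tableauInsert (row :: T) =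
      (rowInsertWord w row).1 :: (rowInsertWord w row).2.foldl tableauInsert T := by
  induction w generalizing row T with
  | nil => rfl
  | cons a w ih =>
    rw [List.foldl_cons, tableauInsert]
    rcases h : rowInsert a row with ⟨r, _ | b⟩ <;> simp [ih, rowInsertWord, h]

lemma rowLength_insertionTableau (w : List ℕ) (k : ℕ) :
    rowLength (insertionTableau w) k = rowLength (w.foldl tableauInsert [[]]) k := by
  cases w with
  | nil => rcases k with _ | _ | k <;> simp [rowLength, insertionTableau]
  | cons a w => rfl

lemma rowLength_insertionTableau_one (w : List ℕ) :
    rowLength (insertionTableau w) 1 = (rowInsertWord w []).1.length := by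
  rw [rowLength_insertionTableau, foldl_tableauInsert_cons]
  rfl

lemma rowLength_insertionTableau_succ (w : List ℕ) (k : ℕ) (hk : 1 ≤ k) :
    rowLength (insertionTableau w) (k + 1) =
      rowLength (insertionTableau (rowInsertWord w []).2) k := by
  obtain ⟨k, rfl⟩ := Nat.exists_eq_add_of_le' hk
  rw [rowLength_insertionTableau, foldl_tableauInsert_cons]
  rfl

lemma rowInsert_perm (a : ℕ) (row : List ℕ) :
    ((rowInsert a row).1 ++ (rowInsert a row).2.toList).Perm (a :: row) := by
  induction row with
  | nil => simp [rowInsert]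
  | cons b r ih =>
    rw [rowInsert]
    split_ifs
    · simp only [Option.toList_some, List.cons_append]
      exact (List.perm_append_singleton b r).cons a
    · exact (ih.cons b).trans (List.Perm.swap _ _ _)

lemma rowInsertWord_perm (w row : List ℕ) :
    ((rowInsertWord w row).1 ++ (rowInsertWord w row).2).Perm (row ++ w) := by
  rw [List.perm_iff_count]
  intro c
  induction w generalizing row with
  | nil => simp [rowInsertWord]
  | cons a w ih =>
    have h1 := ih (rowInsert a row).1
    have h2 := (rowInsert_perm a row).count_eq c
    simp only [rowInsertWord, List.count_append, List.count_cons] at *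
    omega

/-- The row need not be sorted: only the cut between letters at most `a` and letters above `a`
matters. -/
lemma rowInsert_append {a : ℕ} {p q : List ℕ} (hp : ∀ b ∈ p, b ≤ a) (hq : ∀ b ∈ q, a < b) :
    rowInsert a (p ++ q) = (p ++ a :: q.drop 1, q.head?) := by
  induction p with
  | nil =>
    cases q with
    | nil => rfl
    | cons b q => simp [rowInsert, hq b (by simp)]
  | cons b p ih =>
    have hb : ¬ a < b := not_lt.2 (hp b (by simp))
    simp [rowInsert, hb, ih fun c hc => hp c (by simp [hc])]

lemma rowInsertWord_replicate {a : ℕ} (m : ℕ) {p q : List ℕ} (hp : ∀ b ∈ p, b ≤ a)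
    (hq : ∀ b ∈ q, a < b) :
    rowInsertWord (List.replicate m a) (p ++ q) =
      (p ++ List.replicate m a ++ q.drop m, q.take m) := by
  induction m generalizing p q with
  | zero => simp [rowInsertWord]
  | succ m ih =>
    rw [List.replicate_succ, rowInsertWord, rowInsert_append hp hq,
      show p ++ a :: q.drop 1 = (p ++ [a]) ++ q.drop 1 by simp,
      ih (fun b hb => ?_) (fun b hb => hq b (List.mem_of_mem_drop hb))]
    · cases q <;> simp [List.append_assoc]
    · rcases List.mem_append.1 hb with h | h
      · exact hp b h
      · exact (List.mem_singleton.1 h).le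

/-! ### Weakly increasing words -/

/-- The word with `x 1` letters `1`, followed by `x 2` letters `2`, …, and `x K` letters `K`. -/
def block (K : ℕ) (x : ℕ → ℕ) : List ℕ :=
  (List.range K).flatMap fun j => List.replicate (x (j + 1)) (j + 1)

lemma block_succ (K : ℕ) (x : ℕ → ℕ) :
    block (K + 1) x = block K x ++ List.replicate (x (K + 1)) (K + 1) := by
  simp [block, List.range_succ]

lemma word_succ (N K : ℕ) (u : ℕ → ℕ → ℕ) :
    word (N + 1) K u = word N K u ++ block K (u (N + 1)) := by
  simp [word, block, List.range_succ]

lemma le_of_mem_block {K : ℕ} {x : ℕ → ℕ} {a : ℕ} (h : a ∈ block K x) : 1 ≤ a ∧ a ≤ K := by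
  simp only [block, List.mem_flatMap, List.mem_range, List.mem_replicate] at h
  omega

lemma block_pairwise (K : ℕ) (x : ℕ → ℕ) : (block K x).Pairwise (· ≤ ·) := by
  induction K with
  | zero => exact List.Pairwise.nil
  | succ K ih =>
    rw [block_succ, List.pairwise_append]
    refine ⟨ih, List.pairwise_replicate.2 (.inr le_rfl), fun a ha b hb => ?_⟩
    have := le_of_mem_block ha
    rw [List.eq_of_mem_replicate hb]
    omega

lemma count_block (K : ℕ) (x : ℕ → ℕ) (a : ℕ) :
    (block K x).count a = if 1 ≤ a ∧ a ≤ K then x a else 0 := by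
  induction K with
  | zero => simp [block]; omega
  | succ K ih =>
    rw [block_succ, List.count_append, ih, List.count_replicate]
    by_cases h : a = K + 1
    · subst h; simp
    · have h' : ¬ (K + 1 = a) := fun e => h e.symm
      have : a ≤ K + 1 ↔ a ≤ K := by omega
      simp [this, h']

lemma exists_block_eq_append {j K : ℕ} (h : j ≤ K) (x : ℕ → ℕ) :
    ∃ t, block K x = block j x ++ t ∧ ∀ a ∈ t, j < a := by
  induction K, h using Nat.le_induction with
  | base => exact ⟨[], by simp⟩
  | succ K hK ih =>
    obtain ⟨t, ht, hlt⟩ := ih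
    refine ⟨t ++ List.replicate (x (K + 1)) (K + 1), by simp [block_succ, ht], fun a ha => ?_⟩
    rcases List.mem_append.1 ha with h | h
    · exact hlt a h
    · rw [List.eq_of_mem_replicate h]; omega

/-- Insertion of a weakly increasing word in a weakly increasing row. Here `g j` and `g' j` are the
numbers of letters at most `j` in the row, before and after the insertion. -/
lemma rowInsertWord_block_aux {K : ℕ} {x x' y g g' : ℕ → ℕ}
    (hg : ∀ j, (block j x).length = g j) (hg0 : g' 0 = 0)
    (hg' : ∀ j, g' (j + 1) = max (g (j + 1)) (g' j) + y (j + 1))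
    (hx' : ∀ j, x' j = g' j - g' (j - 1)) (j : ℕ) (hj : j ≤ K) :
    (block j x').length = g' j ∧
    (rowInsertWord (block j y) (block K x)).1 = block j x' ++ (block K x).drop (g' j) ∧
    (rowInsertWord (block j y) (block K x)).2.Sublist ((block K x).take (g' j)) := by
  induction j with
  | zero => simp [block, rowInsertWord, hg0]
  | succ j ih =>
    obtain ⟨hl, h1, h2⟩ := ih (by omega)
    have hmono : g' j ≤ g' (j + 1) := by rw [hg']; omega
    have hgj : g j ≤ g' j := by
      cases j with
      | zero => simp [← hg, block]
      | succ j => rw [hg']; omega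
    set r := block K x with hr
    -- The first `g' j` old letters are already displaced or absorbed. From position `M` on, the old
    -- letters exceed `j + 1`, so this is where the letters `j + 1` are inserted.
    set M := max (g (j + 1)) (g' j) with hM
    obtain ⟨t, ht, htlt⟩ := exists_block_eq_append hj x
    have hdrop : r.drop (g' j) = List.replicate (g (j + 1) - g' j) (j + 1) ++ r.drop M := by
      rw [← hr] at ht
      have hgs : g (j + 1) = g j + x (j + 1) := by
        rw [← hg, ← hg, block_succ]; simp
      rw [ht, block_succ, List.append_assoc, List.drop_append, hg, List.drop_append,
        List.drop_append, hg, List.drop_append]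
      simp only [List.drop_replicate, List.length_replicate]
      rw [List.drop_eq_nil_of_le (as := block j x) (i := g' j) (by rw [hg]; omega),
        List.drop_eq_nil_of_le (as := block j x) (i := M) (by rw [hg]; omega),
        show x (j + 1) - (M - g j) = 0 by omega,
        show x (j + 1) - (g' j - g j) = g (j + 1) - g' j by omega,
        show g' j - g j - x (j + 1) = M - g j - x (j + 1) by omega]
      simp
    have hrM : ∀ b ∈ r.drop M, j + 1 < b := by
      intro b hb
      rw [← hr] at ht
      rw [ht, List.drop_append, List.drop_eq_nil_of_le (by rw [hg]; omega), List.nil_append] at hb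
      exact htlt b (List.mem_of_mem_drop hb)
    have hp : ∀ b ∈ block j x' ++ List.replicate (g (j + 1) - g' j) (j + 1), b ≤ j + 1 := by
      intro b hb
      rcases List.mem_append.1 hb with h | h
      · have := le_of_mem_block h; omega
      · exact (List.eq_of_mem_replicate h).le
    have hins := rowInsertWord_replicate (y (j + 1)) hp hrM
    have hx'' : x' (j + 1) = g (j + 1) - g' j + y (j + 1) := by
      rw [hx', hg', Nat.add_sub_cancel]; omega
    have hgM : g' (j + 1) = M + y (j + 1) := hg' j
    rw [block_succ, List.length_append, hl, List.length_replicate, block_succ,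
      rowInsertWord_append, h1, hdrop, ← List.append_assoc, hins]
    refine ⟨by omega, ?_, ?_⟩
    · simp only [List.drop_drop, ← hgM, hx'', List.replicate_add, List.append_assoc]
    · rw [hgM, List.take_add]
      exact (h2.trans (List.take_sublist_take_left (le_max_right _ _))).append
        (List.Sublist.refl _)

/-- The number of letters `j` in the first row at time `n`. -/
def rowArray (u : ℕ → ℕ → ℕ) (n j : ℕ) : ℕ := queueDeparture u j n - queueDeparture u (j - 1) n

lemma length_block_rowArray (u : ℕ → ℕ → ℕ) (n j : ℕ) :
    (block j (rowArray u n)).length = queueDeparture u j n := by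
  induction j with
  | zero => rfl
  | succ j ih =>
    have := queueDeparture_le_succ u j n
    rw [block_succ, List.length_append, ih, List.length_replicate, rowArray, Nat.add_sub_cancel]
    omega

/-- The bumped word is a sublist of the old sorted row, hence sorted, hence determined by its letter
counts; these follow from conservation of letters. -/
lemma rowInsertWord_block (K : ℕ) (u : ℕ → ℕ → ℕ) (n : ℕ) :
    rowInsertWord (block K (u (n + 1))) (block K (rowArray u n)) =
      (block K (rowArray u (n + 1)), block K (bumpArray u (n + 1))) := by
  obtain ⟨hl, h1, h2⟩ := rowInsertWord_block_aux (K := K) (x := rowArray u n)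
    (x' := rowArray u (n + 1)) (y := u (n + 1)) (g := fun j => queueDeparture u j n)
    (g' := fun j => queueDeparture u j (n + 1)) (length_block_rowArray u n) rfl
    (fun j => rfl) (fun j => rfl) K le_rfl
  have hle : (block K (rowArray u n)).length ≤ queueDeparture u K (n + 1) := by
    rw [length_block_rowArray]
    exact queueDeparture_mono u K n.le_succ
  rw [List.drop_eq_nil_of_le hle, List.append_nil] at h1
  have hperm := rowInsertWord_perm (block K (u (n + 1))) (block K (rowArray u n))
  have hsort : (rowInsertWord (block K (u (n + 1))) (block K (rowArray u n))).2.Pairwise (· ≤ ·) :=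
    (block_pairwise K _).sublist (h2.trans (List.take_sublist _ _))
  refine Prod.ext h1 (List.Perm.eq_of_pairwise' hsort (block_pairwise K _) ?_)
  rw [List.perm_iff_count]
  intro a
  have hc := hperm.count_eq a
  simp only [h1, List.count_append, count_block] at hc ⊢
  split_ifs at hc ⊢ with ha
  · obtain ⟨a, rfl⟩ := Nat.exists_eq_add_of_le' ha.1
    have e1 := queueDeparture_le_succ u a n
    have e2 := queueDeparture_le_succ u a (n + 1)
    have e3 : singleQueueDeparture (queueDeparture u a) (fun i => u i (a + 1)) =
        queueDeparture u (a + 1) := rfl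
    simp only [rowArray, bumpArray, queueBump, Nat.add_sub_cancel, e3] at hc ⊢
    omega
  · omega

lemma rowInsertWord_word (N K : ℕ) (u : ℕ → ℕ → ℕ) :
    rowInsertWord (word N K u) [] = (block K (rowArray u N), word N K (bumpArray u)) := by
  induction N with
  | zero =>
    have : block K (rowArray u 0) = [] := by
      rw [← List.length_eq_zero_iff, length_block_rowArray, queueDeparture_zero_right]
    simp [word, rowInsertWord, this]
  | succ N ih => rw [word_succ, rowInsertWord_append, ih, rowInsertWord_block, word_succ]

/-! ### The first and last rows -/

lemma rowLength_word_one (N K : ℕ) (u : ℕ → ℕ → ℕ) :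
    rowLength (insertionTableau (word N K u)) 1 = queueDeparture u K N := by
  rw [rowLength_insertionTableau_one, rowInsertWord_word, length_block_rowArray]

/-- Allowing `s` absent letters makes the induction work: bumping turns `s` into `s + 1` and leaves
the alphabet size `s + (m + 1)` unchanged while one row is deleted. -/
lemma rowLength_word_eq_storeChain {m s : ℕ} (N : ℕ) {u : ℕ → ℕ → ℕ}
    (hu : ∀ n, ∀ j < s, u (n + 1) (j + 1) = 0) :
    rowLength (insertionTableau (word N (s + (m + 1)) u)) (m + 1) =
      storeChain (s + (m + 1)) u m N := by
  induction m generalizing s u with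
  | zero => rw [rowLength_word_one, queueDeparture_succ_of_eq_zero hu]; rfl
  | succ m ih =>
    have hb : ∀ n, ∀ j < s + 1, bumpArray u (n + 1) (j + 1) = 0 := bumpArray_eq_zero hu
    have h := ih hb
    rw [show s + 1 + (m + 1) = s + (m + 1 + 1) by omega] at h
    rw [rowLength_insertionTableau_succ _ _ (by omega), rowInsertWord_word, h,
      storeChain_bumpArray _ _ _ (by omega), storeChain]
    have e : s + (m + 1 + 1) - (m + 1) = s + 1 := by omega
    rw [e]
    refine storeCum_congr (fun n => ?_) N
    rw [increment, queueDeparture_succ_of_eq_zero hu, queueDeparture_succ_of_eq_zero hu,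
      Nat.add_sub_cancel, partialSum_succ, Nat.add_sub_cancel_left]

lemma rowLength_word_last (N K : ℕ) (u : ℕ → ℕ → ℕ) :
    rowLength (insertionTableau (word N (K + 1) u)) (K + 1) = storeChain (K + 1) u K N := by
  have h := rowLength_word_eq_storeChain (m := K) (s := 0) N (u := u) (by simp)
  rwa [Nat.zero_add] at h

/-! ### Lattice paths -/

lemma pathWeight_concat (u : ℕ → ℕ → ℕ) (π : List (ℕ × ℕ)) (p : ℕ × ℕ) :
    pathWeight u (π ++ [p]) = pathWeight u π + u p.1 p.2 := by
  simp [pathWeight]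

lemma isChain_concat {R : ℕ × ℕ → ℕ × ℕ → Prop} {π : List (ℕ × ℕ)} {p q : ℕ × ℕ}
    (h : π.IsChain R) (hp : π.getLast? = some p) (hpq : R p q) : (π ++ [q]).IsChain R := by
  rw [List.isChain_append]
  simp [h, hp, hpq]

lemma concat_mem_upRightPaths {π : List (ℕ × ℕ)} {n j n' j' : ℕ} (h : π ∈ upRightPaths n j)
    (hs : IsUpRightStep (n, j) (n', j')) : π ++ [(n', j')] ∈ upRightPaths n' j' :=
  ⟨by simp [h.1], by simp, isChain_concat h.2.2 h.2.1 hs⟩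

lemma exists_upRightPath (u : ℕ → ℕ → ℕ) (j n : ℕ) :
    ∃ π ∈ upRightPaths (n + 1) (j + 1), pathWeight u π = queueDeparture u (j + 1) (n + 1) := by
  induction j generalizing n with
  | zero =>
    induction n with
    | zero =>
      exact ⟨[(1, 1)], ⟨rfl, rfl, List.isChain_singleton _⟩, by
        simp [pathWeight, queueDeparture, singleQueueDeparture]⟩
    | succ n ih =>
      obtain ⟨π, hπ, hw⟩ := ih
      refine ⟨_, concat_mem_upRightPaths hπ (.inl rfl), ?_⟩
      rw [pathWeight_concat, hw]
      simp [queueDeparture, singleQueueDeparture]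
  | succ j ihj =>
    induction n with
    | zero =>
      obtain ⟨π, hπ, hw⟩ := ihj 0
      refine ⟨_, concat_mem_upRightPaths hπ (.inr rfl), ?_⟩
      rw [pathWeight_concat, hw, queueDeparture.eq_2 u (j + 1)]
      simp [singleQueueDeparture]
    | succ n ih =>
      rw [queueDeparture, singleQueueDeparture, ← queueDeparture]
      rcases le_total (queueDeparture u (j + 1 + 1) (n + 1))
        (queueDeparture u (j + 1) (n + 1 + 1)) with h | h
      · obtain ⟨π, hπ, hw⟩ := ihj (n + 1)
        refine ⟨_, concat_mem_upRightPaths hπ (.inr rfl), ?_⟩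
        rw [pathWeight_concat, hw, max_eq_right h]
      · obtain ⟨π, hπ, hw⟩ := ih
        refine ⟨_, concat_mem_upRightPaths hπ (.inl rfl), ?_⟩
        rw [pathWeight_concat, hw, max_eq_left h]

lemma queueDeparture_succ_succ (u : ℕ → ℕ → ℕ) (j n : ℕ) :
    queueDeparture u (j + 1) (n + 1) =
      max (queueDeparture u (j + 1) n) (queueDeparture u j (n + 1)) + u (n + 1) (j + 1) := rfl

lemma pathWeight_le_queueDeparture (u : ℕ → ℕ → ℕ) (π : List (ℕ × ℕ)) :
    ∀ n j, π ∈ upRightPaths n j → 1 ≤ n ∧ 1 ≤ j ∧ pathWeight u π ≤ queueDeparture u j n := by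
  induction π using List.reverseRecOn with
  | nil => rintro n j ⟨h, -⟩; simp at h
  | append_singleton π q ih =>
    rintro n j ⟨hh, hl, hc⟩
    obtain rfl : q = (n, j) := by simpa using hl
    rw [pathWeight_concat]
    rcases hp : π.getLast? with _ | ⟨n', j'⟩
    · obtain rfl : π = [] := by simpa using hp
      obtain ⟨rfl, rfl⟩ : n = 1 ∧ j = 1 := by simpa using hh
      simp [pathWeight, queueDeparture, singleQueueDeparture]
    · rw [List.isChain_append] at hc
      have hne : π ≠ [] := by rintro rfl; simp at hp
      obtain ⟨h1, h2, h3⟩ := ih n' j' ⟨by rwa [List.head?_append_of_ne_nil _ hne] at hh, hp, hc.1⟩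
      have hs := hc.2.2 (n', j') (by simp [hp]) (n, j) (by simp)
      rcases hs with hs | hs <;> obtain ⟨rfl, rfl⟩ := Prod.mk.inj hs
      · obtain ⟨j, rfl⟩ : ∃ i, j = i + 1 := ⟨j - 1, by omega⟩
        have := queueDeparture_succ_succ u j n'
        simp only at *
        omega
      · obtain ⟨n, rfl⟩ : ∃ i, n = i + 1 := ⟨n - 1, by omega⟩
        have := queueDeparture_succ_succ u j' n
        simp only at *
        omega

lemma isGreatest_upRightPaths (u : ℕ → ℕ → ℕ) {n j : ℕ} (hn : 1 ≤ n) (hj : 1 ≤ j) :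
    IsGreatest (pathWeight u '' upRightPaths n j) (queueDeparture u j n) := by
  obtain ⟨n, rfl⟩ := Nat.exists_eq_add_of_le' hn
  obtain ⟨j, rfl⟩ := Nat.exists_eq_add_of_le' hj
  refine ⟨exists_upRightPath u j n, ?_⟩
  rintro _ ⟨π, hπ, rfl⟩
  exact (pathWeight_le_queueDeparture u π _ _ hπ).2.2

/-! ### Down paths and the minimum recursion of the stores -/

lemma storeChain_succ_le (K : ℕ) (u : ℕ → ℕ → ℕ) (m n : ℕ) :
    storeChain K u m (n + 1) ≤ storeChain K u m n + u (n + 1) (K - m) := by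
  cases m with
  | zero => simp [storeChain, partialSum_succ]
  | succ m => exact min_le_left _ _

/-- A store cannot release more than was supplied to it one slot earlier. On the path side, a step
`(1 + i, -i)` is a weighted step `(1, 0)` combined with `i` free moves `(1, -1)`. -/
lemma storeChain_add_le (K : ℕ) (u : ℕ → ℕ → ℕ) (m n i : ℕ) :
    storeChain K u (m + i) (n + i) ≤ storeChain K u m n := by
  induction i with
  | zero => exact le_rfl
  | succ i ih => exact (min_le_right _ _).trans ih

/-- The paths from the first antidiagonal to the antidiagonal of the point `(n, r)`. -/
def downPathsTo (K n r : ℕ) : Set (List (ℕ × ℕ)) :=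
  {π | (∃ i < K, π.head? = some (1 + i, K - i)) ∧
    (∃ j < n, π.getLast? = some (n - j, r + j)) ∧ π.IsChain IsDownStep}

lemma concat_mem_downPathsTo {K n r : ℕ} {π : List (ℕ × ℕ)} (h : π ∈ downPathsTo K n r) :
    π ++ [(n + 1, r)] ∈ downPathsTo K (n + 1) r := by
  obtain ⟨⟨i, hi, hh⟩, ⟨j, hj, hl⟩, hc⟩ := h
  refine ⟨⟨i, hi, by simp [hh]⟩, ⟨0, by omega, by simp⟩, isChain_concat hc hl ⟨j, ?_, rfl⟩⟩
  change n + 1 = n - j + (1 + j)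
  omega

lemma singleton_mem_downPathsTo {K m : ℕ} (hm : m < K) :
    [(m + 1, K - m)] ∈ downPathsTo K (m + 1) (K - m) :=
  ⟨⟨m, hm, by simp [Nat.add_comm]⟩, ⟨0, by omega, by simp⟩, List.isChain_singleton _⟩

lemma exists_downPath_of_eq_add {K m n : ℕ} (u : ℕ → ℕ → ℕ) (hm : m < K) (hn : m ≤ n)
    (ih : m + 1 ≤ n → ∃ π ∈ downPathsTo K n (K - m), pathWeight u π = storeChain K u m n)
    (h : storeChain K u m (n + 1) = storeChain K u m n + u (n + 1) (K - m)) :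
    ∃ π ∈ downPathsTo K (n + 1) (K - m), pathWeight u π = storeChain K u m (n + 1) := by
  rcases hn.eq_or_lt with rfl | hlt
  · refine ⟨_, singleton_mem_downPathsTo hm, ?_⟩
    rw [h, storeChain_eq_zero K u m m le_rfl]
    simp [pathWeight]
  -- For `n = m` nothing has departed yet, so the path starts at this very point of the first
  -- antidiagonal.
  · obtain ⟨π, hπ, hw⟩ := ih hlt
    exact ⟨_, concat_mem_downPathsTo hπ, by rw [pathWeight_concat, hw, h]⟩

lemma exists_downPath (K : ℕ) (u : ℕ → ℕ → ℕ) (m n : ℕ) (hm : m < K) (hn : m + 1 ≤ n) :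
    ∃ π ∈ downPathsTo K n (K - m), pathWeight u π = storeChain K u m n := by
  induction m generalizing n with
  | zero =>
    induction n with
    | zero => omega
    | succ n ih =>
      exact exists_downPath_of_eq_add u hm (by omega) ih (by simp [storeChain, partialSum_succ])
  | succ m ihm =>
    induction n with
    | zero => omega
    | succ n ih =>
      rcases le_total (storeChain K u (m + 1) n + u (n + 1) (K - (m + 1))) (storeChain K u m n)
        with h | h
      · exact exists_downPath_of_eq_add u hm (by omega) ih (min_eq_left h)
      -- When the supply is the minimum, the path is kept unchanged: `(n, K - m)` and `(n + 1, K -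
      -- (m + 1))` lie on the same antidiagonal, and only the offset `j` shifts.
      · obtain ⟨π, ⟨hh, ⟨j, hj, hl⟩, hc⟩, hw⟩ := ihm n (by omega) (by omega)
        refine ⟨π, ⟨hh, ⟨j + 1, by omega, ?_⟩, hc⟩, hw.trans (min_eq_right h).symm⟩
        rw [hl, show n + 1 - (j + 1) = n - j by omega,
          show K - (m + 1) + (j + 1) = K - m + j by omega]

lemma storeChain_le_pathWeight (K : ℕ) (u : ℕ → ℕ → ℕ) (π : List (ℕ × ℕ)) :
    ∀ x y, (∃ i < K, π.head? = some (1 + i, K - i)) → π.getLast? = some (x, y) →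
      π.IsChain IsDownStep → y ≤ K ∧ (1 ≤ y → storeChain K u (K - y) x ≤ pathWeight u π) := by
  induction π using List.reverseRecOn with
  | nil => rintro x y ⟨i, -, h⟩; simp at h
  | append_singleton π q ih =>
    rintro x y ⟨i, hi, hh⟩ hl hc
    obtain rfl : q = (x, y) := by simpa using hl
    rw [pathWeight_concat]
    rcases hp : π.getLast? with _ | ⟨x', y'⟩
    · obtain rfl : π = [] := by simpa using hp
      obtain ⟨rfl, rfl⟩ : x = 1 + i ∧ y = K - i := by simpa using hh
      refine ⟨by omega, fun _ => ?_⟩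
      have h := storeChain_succ_le K u i i
      rw [storeChain_eq_zero K u i i le_rfl] at h
      rw [show K - (K - i) = i by omega, Nat.add_comm 1 i]
      simpa [pathWeight] using h
    · rw [List.isChain_append] at hc
      have hne : π ≠ [] := by rintro rfl; simp at hp
      obtain ⟨h1, h2⟩ := ih x' y' ⟨i, hi, by rwa [List.head?_append_of_ne_nil _ hne] at hh⟩ hp hc.1
      obtain ⟨k, hx, hy⟩ := hc.2.2 (x', y') (by simp [hp]) (x, y) (by simp)
      simp only at hx hy
      refine ⟨by omega, fun hy1 => ?_⟩
      have h3 := h2 (by omega)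
      have h4 := storeChain_add_le K u (K - y') x' k
      have h5 := storeChain_succ_le K u (K - y) (x' + k)
      rw [show K - y' + k = K - y by omega] at h4
      rw [show x' + k + 1 = x by omega, show K - (K - y) = y by omega] at h5
      simp only
      omega

lemma isLeast_downPaths (u : ℕ → ℕ → ℕ) {N K : ℕ} (hK : K + 1 ≤ N) :
    IsLeast (pathWeight u '' downPaths N (K + 1)) (storeChain (K + 1) u K N) := by
  constructor
  · obtain ⟨π, hπ, hw⟩ := exists_downPath (K + 1) u K N K.lt_succ_self hK
    -- With `r = 1`, `downPathsTo` is `downPaths` by definition.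
    rw [show K + 1 - K = 1 by omega] at hπ
    exact ⟨π, hπ, hw⟩
  · rintro _ ⟨π, ⟨hh, ⟨j, hj, hl⟩, hc⟩, rfl⟩
    obtain ⟨h1, h2⟩ := storeChain_le_pathWeight (K + 1) u π _ _ hh hl hc
    have h3 := storeChain_add_le (K + 1) u (K + 1 - (1 + j)) (N - j) j
    rw [show K + 1 - (1 + j) + j = K by omega, show N - j + j = N by omega] at h3
    exact h3.trans (h2 (by omega))

end Tandem

theorem theorem3 (N K : ℕ) (hN : 1 ≤ N) (hK : 1 ≤ K) (u : ℕ → ℕ → ℕ) :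
    (IsGreatest (Tandem.pathWeight u '' Tandem.upRightPaths N K)
        (Tandem.rowLength (Tandem.insertionTableau (Tandem.word N K u)) 1) ∧
      Tandem.rowLength (Tandem.insertionTableau (Tandem.word N K u)) 1 =
        Tandem.queueDeparture u K N) ∧
    ((K ≤ N → IsLeast (Tandem.pathWeight u '' Tandem.downPaths N K)
        (Tandem.rowLength (Tandem.insertionTableau (Tandem.word N K u)) K)) ∧
      (N < K → Tandem.rowLength (Tandem.insertionTableau (Tandem.word N K u)) K = 0) ∧
      Tandem.rowLength (Tandem.insertionTableau (Tandem.word N K u)) K =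
        Tandem.totalStoreDeparture N K u) := by
  rw [Tandem.rowLength_word_one]
  refine ⟨⟨Tandem.isGreatest_upRightPaths u hN hK, rfl⟩, ?_⟩
  obtain ⟨K, rfl⟩ := Nat.exists_eq_add_of_le' hK
  rw [Tandem.rowLength_word_last]
  exact ⟨Tandem.isLeast_downPaths u, fun h => Tandem.storeChain_eq_zero _ _ _ _ (by omega),
    (Tandem.totalStoreDeparture_eq_storeChain N K u).symm⟩
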